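/- Let $(M,g)$ be a connected compact smooth Riemannian manifold without boundary, let $V:M\to\mathbb R$ be smooth, and let $H(x,\xi)=\tfrac12|\xi|_g^2+V(x)$ and, for $t>0$, $H_t(x,\xi)=t^2H(x,t^{-1}\xi)=\tfrac12|\xi|_g^2+t^2V(x)$ on $T^*M$. For a Hamiltonian $K$ on $T^*M$, $t>0$, $x,y\in M$ and $\mu\in\mathbb R$, let $\Gamma^{K}_{t,x,y}(\mu)$ be the set of integral curves $(x(s),\xi(s))$, $s\in[0,t]$, of the Hamilton vector field of $K$ with $x(0)=y$, $x(t)=x$ and $|\xi(0)|_g<\mu$. If this set has exactly one element for some $\mu$, that element (which does not depend on $\mu$) is called the lowest energy classical path of $K$ from $y$ to $x$ in the time $t$. Let $t_0>0$, $\mu\in\mathbb R$ and a neighborhood $N\subset M\times M$ of the diagonal be such that $\Gamma^{H}_{t,x,y}(\mu/t)$ has exactly one element for all $t\in(0,t_0)$ and $(x,y)\in N$. Then for all $t\in(0,t_0)$ and $(x,y)\in N$ the set $\Gamma^{H_t}_{1,x,y}(\mu)$ also has exactly one element, and $$S(t,x,y)=t^{-1}\,\Phi(t,x,y).$$ Here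 $$S(t,x,y)=\int_0^t\Big(\tfrac12\big|\tfrac{d}{ds}x_s\big|_g^2-V(x_s)\Big)ds,\qquad \Phi(t,x,y)=\int_0^1\Big(\tfrac12\big|\tfrac{d}{ds}q_s\big|_g^2-t^2V(q_s)\Big)ds,$$ where $x_s$ and $q_s$ are the projections to $M$ of the lowest energy classical path of $H$ from $y$ to $x$ in the time $t$, and of the lowest energy classical path of $H_t$ from $y$ to $x$ in the time $1$, respectively. -/

import Mathlib

open Set Bundle
open scoped Manifold ContDiff Topology Bundle

noncomputable section

namespace LowEnergy

/-- The model space `ℝⁿ`. -/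
abbrev Model (n : ℕ) : Type := EuclideanSpace ℝ (Fin n)

/-- The cotangent bundle `T*M`: pairs of a point `x` of `M` and a linear form on `T_x M`. -/
abbrev Cotangent (n : ℕ) (M : Type*) [TopologicalSpace M] [ChartedSpace (Model n) M] : Type _ :=
  TotalSpace (Model n →L[ℝ] ℝ) (fun x : M => TangentSpace (𝓡 n) x →L[ℝ] ℝ)

section Coordinates

variable {n : ℕ} {M : Type*} [TopologicalSpace M] [ChartedSpace (Model n) M]
  [IsManifold (𝓡 n) ∞ M]

/-- The base coordinates `(x₁, …, xₙ)` of a point of `T*M` in the chart `φ` at `c`. -/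
def posCoord (c : M) (z : Cotangent n M) : Model n := extChartAt (𝓡 n) c z.proj

/-- The fibre coordinates `(ξ₁, …, ξₙ)` of a point `(x, ξ)` of `T*M` in the canonical coordinates
associated with the chart `φ` at `c`, i.e. the linear form `ξ ∘ (dφ_x)⁻¹` on `ℝⁿ`. (For `x` in the
chart domain, `symmL` of the tangent trivialization at `c` is `(dφ_x)⁻¹`.) -/
def momCoord (c : M) (z : Cotangent n M) : Model n →L[ℝ] ℝ :=
  z.2.comp ((trivializationAt (Model n) (TangentSpace (𝓡 n)) c).symmL ℝ z.proj)

/-- The point of `T*M` with canonical coordinates `(q, p)` with respect to the chart `φ` at `c`: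
base point `x = φ⁻¹(q)` and linear form `p ∘ dφ_x`. (For `x` in the chart domain,
`continuousLinearMapAt` of the tangent trivialization at `c` is `dφ_x`.) -/
def ofCoord (c : M) (q : Model n) (p : Model n →L[ℝ] ℝ) : Cotangent n M :=
  ⟨(extChartAt (𝓡 n) c).symm q,
    p.comp ((trivializationAt (Model n) (TangentSpace (𝓡 n)) c).continuousLinearMapAt ℝ
      ((extChartAt (𝓡 n) c).symm q))⟩

/-- On the domain of the canonical coordinates, `ofCoord` inverts `(posCoord, momCoord)`. -/
theorem ofCoord_coord (c : M) (z : Cotangent n M)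
    (hz : z.proj ∈ (chartAt (Model n) c).source) :
    ofCoord c (posCoord c z) (momCoord c z) = z := by
  obtain ⟨x, ξ⟩ := z
  have hx : (extChartAt (𝓡 n) c).symm (extChartAt (𝓡 n) c x) = x :=
    (extChartAt (𝓡 n) c).left_inv (by simpa using hz)
  have key : ∀ y : M, y = x →
      (⟨y, (momCoord c (⟨x, ξ⟩ : Cotangent n M)).comp
        ((trivializationAt (Model n) (TangentSpace (𝓡 n)) c).continuousLinearMapAt ℝ y)⟩ :
          Cotangent n M) = ⟨x, ξ⟩ := by
    rintro y rfl
    congr 1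
    ext v
    have hy : y ∈ (trivializationAt (Model n) (TangentSpace (𝓡 n)) c).baseSet := by
      simpa using hz
    have := (trivializationAt (Model n) (TangentSpace (𝓡 n)) c).symmL_continuousLinearMapAt
      (R := ℝ) hy v
    simp only [momCoord, ContinuousLinearMap.comp_apply]
    exact congrArg ξ this
  exact key _ hx

/-- `γ : [0, t] → T*M` is a classical path of the (differentiable) Hamiltonian `H` on `T*M`,
i.e. an integral curve of the Hamilton vector field of `H`: its projection to `M` is continuous
and, in canonical coordinates `(q, p)` of every chart, Hamilton's equations
`dq/ds = ∂H/∂p`, `dp/ds = -∂H/∂q` hold. The two equations are tested against an arbitrary linear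
form `α` and an arbitrary vector `v` (the components of `q` and `p`); at the end points of
`[0, t]` the derivatives are one-sided. Only the values of `γ` on `[0, t]` matter. -/
def IsClassicalPath (H : Cotangent n M → ℝ) (t : ℝ) (γ : ℝ → Cotangent n M) : Prop :=
  ContinuousOn (fun s => (γ s).proj) (Icc 0 t) ∧
  ∀ s ∈ Icc 0 t, ∀ c : M, (γ s).proj ∈ (chartAt (Model n) c).source →
    (∀ α : Model n →L[ℝ] ℝ,
      HasDerivWithinAt (fun u => α (posCoord c (γ u)))
        (fderiv ℝ (fun p => H (ofCoord c (posCoord c (γ s)) p)) (momCoord c (γ s)) α)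
        (Icc 0 t) s) ∧
    (∀ v : Model n,
      HasDerivWithinAt (fun u => momCoord c (γ u) v)
        (-(fderiv ℝ (fun q => H (ofCoord c q (momCoord c (γ s)))) (posCoord c (γ s)) v))
        (Icc 0 t) s)

/-- The set `Γ^H_{t,x,y}` of classical paths of `H` on `[0, t]` from `y` to `x`. -/
def classicalPaths (H : Cotangent n M → ℝ) (t : ℝ) (x y : M) : Set (ℝ → Cotangent n M) :=
  {γ | IsClassicalPath H t γ ∧ (γ 0).proj = y ∧ (γ t).proj = x}

variable [RiemannianBundle (fun x : M => TangentSpace (𝓡 n) x)]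

/-- The set `Γ^H_{t,x,y}(μ)` of classical paths of `H` on `[0, t]` from `y` to `x` whose initial
momentum satisfies `|ξ(0)|_g < μ`. The norm of a covector is the norm dual to the Riemannian norm
on the tangent space. -/
def lowPaths (H : Cotangent n M → ℝ) (t : ℝ) (x y : M) (μ : ℝ) : Set (ℝ → Cotangent n M) :=
  {γ | γ ∈ classicalPaths H t x y ∧ ‖(γ 0).2‖ < μ}

/-- `γ` is the only element of `Γ^H_{t,x,y}(μ)`. As paths are defined on `[0, t]`, two of them
are the same when they agree on `[0, t]`. -/
def IsOnlyLowPath (H : Cotangent n M → ℝ) (t : ℝ) (x y : M) (μ : ℝ)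
    (γ : ℝ → Cotangent n M) : Prop :=
  γ ∈ lowPaths H t x y μ ∧ ∀ γ' ∈ lowPaths H t x y μ, EqOn γ' γ (Icc 0 t)

/-- `γ` is the lowest energy classical path of `H` from `y` to `x` in the time `t`: the unique
element of `Γ^H_{t,x,y}(μ)` for some `μ`. -/
def IsLowestEnergyPath (H : Cotangent n M → ℝ) (t : ℝ) (x y : M)
    (γ : ℝ → Cotangent n M) : Prop :=
  ∃ μ : ℝ, IsOnlyLowPath H t x y μ γ

/-- The lowest energy path does not depend on the bound `μ` used to single it out. -/
theorem IsLowestEnergyPath.eqOn {H : Cotangent n M → ℝ} {t : ℝ} {x y : M}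
    {γ γ' : ℝ → Cotangent n M} (h : IsLowestEnergyPath H t x y γ)
    (h' : IsLowestEnergyPath H t x y γ') : EqOn γ γ' (Icc 0 t) := by
  obtain ⟨μ, hγ, hu⟩ := h
  obtain ⟨μ', hγ', hu'⟩ := h'
  rcases le_total μ μ' with hle | hle
  · exact hu' γ ⟨hγ.1, hγ.2.trans_le hle⟩
  · exact (hu γ' ⟨hγ'.1, hγ'.2.trans_le hle⟩).symm

open Classical in
/-- The lowest energy classical path of `H` from `y` to `x` in the time `t` (a constant path as
a default value where there is none). On `[0, t]` it is unique. -/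
def lowestEnergyPath (H : Cotangent n M → ℝ) (t : ℝ) (x y : M) : ℝ → Cotangent n M :=
  if h : ∃ γ, IsLowestEnergyPath H t x y γ then h.choose else fun _ => ⟨x, 0⟩

/-- The Hamiltonian `H(x, ξ) = |ξ|_g² / 2 + V(x)`. -/
def hamiltonian (V : M → ℝ) (z : Cotangent n M) : ℝ := ‖z.2‖ ^ 2 / 2 + V z.proj

/-- The scaled Hamiltonian `H_t(x, ξ) = |ξ|_g² / 2 + t² V(x)`. -/
def scaledHamiltonian (V : M → ℝ) (t : ℝ) (z : Cotangent n M) : ℝ :=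
  ‖z.2‖ ^ 2 / 2 + t ^ 2 * V z.proj

/-- The dual norm is homogeneous. -/
theorem norm_smul_covector (x : M) (a : ℝ) (ξ : TangentSpace (𝓡 n) x →L[ℝ] ℝ) :
    ‖a • ξ‖ = |a| * ‖ξ‖ := by
  have h : ∀ (b : ℝ) (η : TangentSpace (𝓡 n) x →L[ℝ] ℝ), ‖b • η‖ ≤ |b| * ‖η‖ := by
    intro b η
    refine ContinuousLinearMap.opNorm_le_bound (b • η) (by positivity) fun v => ?_
    have h1 : ‖η v‖ ≤ ‖η‖ * ‖v‖ := ContinuousLinearMap.le_opNorm η v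
    have h2 : ‖(b • η) v‖ = |b| * ‖η v‖ := by
      change ‖b * η v‖ = _
      rw [norm_mul, Real.norm_eq_abs]
    rw [h2, mul_assoc]
    exact mul_le_mul_of_nonneg_left h1 (abs_nonneg b)
  refine le_antisymm (h a ξ) ?_
  rcases eq_or_ne a 0 with rfl | ha
  · rw [abs_zero, zero_mul]
    exact ContinuousLinearMap.opNorm_nonneg _
  · have h3 := h a⁻¹ (a • ξ)
    rw [smul_smul, inv_mul_cancel₀ ha, one_smul, abs_inv] at h3
    have h4 : 0 < |a| := abs_pos.mpr ha
    rwa [inv_mul_eq_div, le_div_iff₀ h4, mul_comm] at h3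

/-- `H_t(x, ξ) = t² H(x, t⁻¹ ξ)` for `t ≠ 0`. -/
theorem scaledHamiltonian_eq (V : M → ℝ) {t : ℝ} (ht : t ≠ 0) (z : Cotangent n M) :
    scaledHamiltonian V t z = t ^ 2 * hamiltonian V (⟨z.proj, t⁻¹ • z.2⟩ : Cotangent n M) := by
  have h := norm_smul_covector z.proj t⁻¹ z.2
  have h2 : |t⁻¹| ^ 2 = (t ^ 2)⁻¹ := by rw [sq_abs, inv_pow]
  simp only [scaledHamiltonian, hamiltonian]
  rw [h, mul_pow, h2]
  field_simp

/-- The square `|dx/ds|_g²` of the Riemannian length of the velocity at the time `s` of a curve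
`x : [0, t] → M` (one-sided velocity at the end points). -/
def speedSq (t : ℝ) (x : ℝ → M) (s : ℝ) : ℝ :=
  ‖(mfderivWithin 𝓘(ℝ, ℝ) (𝓡 n) x (Icc 0 t) s (1 : ℝ) : TangentSpace (𝓡 n) (x s))‖ ^ 2

/-- The action `S(t, x, y) = ∫₀ᵗ (|dx/ds|_g² / 2 - V(x)) ds` along the lowest energy path of
`H = |ξ|_g² / 2 + V` from `y` to `x` in the time `t`. -/
def actionS (V : M → ℝ) (t : ℝ) (x y : M) : ℝ :=
  ∫ s in (0 : ℝ)..t,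
    (speedSq (n := n) t (fun u => (lowestEnergyPath (n := n) (hamiltonian V) t x y u).proj) s / 2
      - V (lowestEnergyPath (n := n) (hamiltonian V) t x y s).proj)

/-- The action `Φ(t, x, y) = ∫₀¹ (|dq/ds|_g² / 2 - t² V(q)) ds` along the lowest energy path of
the scaled Hamiltonian `H_t` from `y` to `x` in the time `1`. -/
def actionPhi (V : M → ℝ) (t : ℝ) (x y : M) : ℝ :=
  ∫ s in (0 : ℝ)..1,
    (speedSq (n := n) 1
        (fun u => (lowestEnergyPath (n := n) (scaledHamiltonian V t) 1 x y u).proj) s / 2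
      - t ^ 2 * V (lowestEnergyPath (n := n) (scaledHamiltonian V t) 1 x y s).proj)

end Coordinates

end LowEnergy

end

namespace LowEnergy

/-! Since `H_t(x, tξ) = t² H(x, ξ)`, the map `(x(s), ξ(s)) ↦ (x(ts), t ξ(ts))` carries Hamilton's
equations for `H` on `[0, t]` to those for `H_t` on `[0, 1]` (`IsClassicalPath.rescale`). It fixes
the end points, multiplies the initial momentum by `t`, and is inverted by the same construction
with `t⁻¹`, so existence and uniqueness pass from the bound `μ / t` to the bound `μ`
(`IsOnlyLowPath.rescale`). For the actions, squared speed gains a factor `t²` (`speedSq_comp_mul`),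
so the integrand of `Φ` at `s` is `t²` times that of `S` at `ts`. The substitution `r = ts` costs
`t⁻¹`, whence `Φ = t S`. -/

/-- No differentiability of `f` is needed: scaling by a nonzero constant preserves
non-differentiability, and then both sides are the default `0`. -/
theorem fderiv_sq_mul_comp_inv_smul {E : Type*} [NormedAddCommGroup E] [NormedSpace ℝ E]
    (f : E → ℝ) {a : ℝ} (ha : a ≠ 0) (p : E) :
    fderiv ℝ (fun x => a ^ 2 * f (a⁻¹ • x)) (a • p) = a • fderiv ℝ f p := by
  have h1 : fderiv ℝ (fun x => a ^ 2 * f (a⁻¹ • x)) (a • p) =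
      a ^ 2 • fderiv ℝ (fun x => f (a⁻¹ • x)) (a • p) :=
    congrFun (fderiv_const_smul_field (𝕜 := ℝ) (f := fun x => f (a⁻¹ • x)) (a ^ 2)) (a • p)
  rw [h1, fderiv_comp_smul, inv_smul_smul₀ ha, smul_smul]
  congr 1
  field_simp

section Scaling

variable {n : ℕ} {M : Type*} [TopologicalSpace M] [ChartedSpace (EuclideanSpace ℝ (Fin n)) M]
  [IsManifold (𝓡 n) ∞ M]

/-- The fibrewise dilation `(x, ξ) ↦ (x, a ξ)` of `T*M`. -/
noncomputable def dilate (a : ℝ) (z : Cotangent n M) : Cotangent n M := ⟨z.proj, a • z.2⟩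

/-- The path `s ↦ (x(a s), a ξ(a s))`. -/
noncomputable def rescale (a : ℝ) (γ : ℝ → Cotangent n M) (s : ℝ) : Cotangent n M := dilate a (γ (a * s))

omit [IsManifold (𝓡 n) ∞ M] in
theorem dilate_dilate (a b : ℝ) (z : Cotangent n M) :
    dilate a (dilate b z) = dilate (a * b) z := by
  exact congrArg (TotalSpace.mk z.proj) (smul_smul a b z.2)

omit [IsManifold (𝓡 n) ∞ M] in
theorem dilate_one (z : Cotangent n M) : dilate 1 z = z := by
  simp only [dilate, one_smul]

omit [IsManifold (𝓡 n) ∞ M] in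
theorem rescale_rescale_inv {a : ℝ} (ha : a ≠ 0) (γ : ℝ → Cotangent n M) :
    rescale a (rescale a⁻¹ γ) = γ := by
  funext s
  simp only [rescale, dilate_dilate, mul_inv_cancel₀ ha, dilate_one, inv_mul_cancel_left₀ ha]

theorem ofCoord_smul (c : M) (a : ℝ) (q : Model n) (p : Model n →L[ℝ] ℝ) :
    ofCoord c q (a • p) = dilate a (ofCoord c q p) := rfl

theorem mapsTo_mul_Icc {a : ℝ} (ha : 0 < a) (T : ℝ) :
    MapsTo (fun s => a * s) (Icc 0 T) (Icc 0 (a * T)) := fun _ hs =>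
  ⟨mul_nonneg ha.le hs.1, mul_le_mul_of_nonneg_left hs.2 ha.le⟩

/-- Rescaling turns the classical paths of `K` into classical paths of every Hamiltonian `L` with
`L(x, a ξ) = a² K(x, ξ)`. -/
theorem IsClassicalPath.rescale {K L : Cotangent n M → ℝ} {a T : ℝ} (ha : 0 < a)
    (hL : ∀ z, L (dilate a z) = a ^ 2 * K z) {γ : ℝ → Cotangent n M}
    (hγ : IsClassicalPath K (a * T) γ) : IsClassicalPath L T (rescale a γ) := by
  have hmaps := mapsTo_mul_Icc ha T
  refine ⟨hγ.1.comp (by fun_prop) hmaps, fun s hs c hc => ?_⟩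
  obtain ⟨h1, h2⟩ := hγ.2 (a * s) (hmaps hs) c hc
  have hmul : HasDerivWithinAt (fun u : ℝ => a * u) a (Icc 0 T) s := by
    simpa using (hasDerivWithinAt_id s (Icc 0 T)).const_mul a
  refine ⟨fun α => ?_, fun v => ?_⟩
  · have hF : (fun p => L (ofCoord c (posCoord c (γ (a * s))) p)) =
        fun p => a ^ 2 * (fun p => K (ofCoord c (posCoord c (γ (a * s))) p)) (a⁻¹ • p) := by
      funext p
      have hp : p = a • (a⁻¹ • p) := by rw [smul_smul, mul_inv_cancel₀ ha.ne', one_smul]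
      change L _ = a ^ 2 * K _
      conv_lhs => rw [hp, ofCoord_smul, hL]
    have h := (h1 α).comp s hmul hmaps
    refine h.congr_deriv ?_
    change _ = fderiv ℝ (fun p => L (ofCoord c (posCoord c (γ (a * s))) p))
      (a • momCoord c (γ (a * s))) α
    have hd := fderiv_sq_mul_comp_inv_smul
      (fun p => K (ofCoord c (posCoord c (γ (a * s))) p)) ha.ne' (momCoord c (γ (a * s)))
    rw [hF]
    exact (mul_comm _ _).trans (DFunLike.congr_fun hd α).symm
  · have hF : (fun q => L (ofCoord c q (a • momCoord c (γ (a * s))))) =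
        a ^ 2 • fun q => K (ofCoord c q (momCoord c (γ (a * s)))) := by
      funext q
      rw [ofCoord_smul, hL]
      rfl
    -- One factor `a` comes from the time change and one from the fibre dilation; together they
    -- match the `a ^ 2` in `hF`.
    have h := ((h2 v).comp s hmul hmaps).const_mul a
    refine h.congr_deriv ?_
    change _ = -(fderiv ℝ (fun q => L (ofCoord c q (a • momCoord c (γ (a * s)))))
      (posCoord c (γ (a * s))) v)
    rw [hF, fderiv_const_smul_field]
    simp only [FunLike.coe_smul, Pi.smul_apply, smul_eq_mul]
    ring

variable [RiemannianBundle (fun x : M => TangentSpace (𝓡 n) x)]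

theorem rescale_mem_lowPaths {K L : Cotangent n M → ℝ} {a T μ : ℝ} (ha : 0 < a)
    (hL : ∀ z, L (dilate a z) = a ^ 2 * K z) {x y : M} {γ : ℝ → Cotangent n M}
    (hγ : γ ∈ lowPaths K (a * T) x y μ) : rescale a γ ∈ lowPaths L T x y (a * μ) := by
  obtain ⟨⟨hγ, h0, hT⟩, hμ⟩ := hγ
  refine ⟨⟨hγ.rescale ha hL, ?_, hT⟩, ?_⟩
  · change (γ (a * 0)).proj = y
    rwa [mul_zero]
  · change ‖a • (γ (a * 0)).2‖ < a * μ
    rw [norm_smul_covector, mul_zero, abs_of_pos ha]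
    exact mul_lt_mul_of_pos_left hμ ha

/-- The homogeneity relation is symmetric under `a ↔ a⁻¹`, `K ↔ L`, so any competitor for `L` pulls
back to one for `K`, where uniqueness applies. -/
theorem IsOnlyLowPath.rescale {K L : Cotangent n M → ℝ} {a T μ : ℝ} (ha : 0 < a)
    (hL : ∀ z, L (dilate a z) = a ^ 2 * K z) {x y : M} {γ : ℝ → Cotangent n M}
    (hγ : IsOnlyLowPath K (a * T) x y μ γ) :
    IsOnlyLowPath L T x y (a * μ) (rescale a γ) := by
  refine ⟨rescale_mem_lowPaths ha hL hγ.1, fun γ' hγ' => ?_⟩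
  have hK : ∀ z, K (dilate a⁻¹ z) = a⁻¹ ^ 2 * L z := fun z => by
    have h := hL (dilate a⁻¹ z)
    rw [dilate_dilate, mul_inv_cancel₀ ha.ne', dilate_one] at h
    rw [h]
    field_simp
  have hmem : LowEnergy.rescale a⁻¹ γ' ∈ lowPaths K (a * T) x y μ := by
    have h := rescale_mem_lowPaths (T := a * T) (μ := a * μ) (inv_pos.2 ha) hK
      (by rwa [inv_mul_cancel_left₀ ha.ne'] : γ' ∈ lowPaths L (a⁻¹ * (a * T)) x y (a * μ))
    rwa [inv_mul_cancel_left₀ ha.ne'] at h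
  intro s hs
  have h := hγ.2 _ hmem (mapsTo_mul_Icc ha T hs)
  rw [← rescale_rescale_inv ha.ne' γ']
  exact congrArg (dilate a) h

theorem isLowestEnergyPath_lowestEnergyPath {H : Cotangent n M → ℝ} {t : ℝ} {x y : M}
    (h : ∃ γ, IsLowestEnergyPath H t x y γ) :
    IsLowestEnergyPath H t x y (lowestEnergyPath H t x y) := by
  rw [lowestEnergyPath, dif_pos h]
  exact h.choose_spec

theorem scaledHamiltonian_dilate (V : M → ℝ) (t : ℝ) (z : Cotangent n M) :
    scaledHamiltonian V t (dilate t z) = t ^ 2 * hamiltonian V z := by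
  have h := norm_smul_covector z.proj t z.2
  change ‖t • z.2‖ ^ 2 / 2 + t ^ 2 * V z.proj = t ^ 2 * (‖z.2‖ ^ 2 / 2 + V z.proj)
  rw [h, mul_pow, sq_abs]
  ring

-- Serves to compare norms in tangent spaces whose base points are equal only propositionally, by
-- viewing the vectors in the common model space.
omit [IsManifold (𝓡 n) ∞ M] in
theorem norm_tangent_congr {p q : M} (h : p = q) {v : TangentSpace (𝓡 n) p}
    {w : TangentSpace (𝓡 n) q} (hv : (show Model n from v) = (show Model n from w)) :
    ‖v‖ = ‖w‖ := by
  subst h hv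
  rfl

omit [IsManifold (𝓡 n) ∞ M] in
theorem speedSq_congr {t : ℝ} {x x' : ℝ → M} (h : EqOn x x' (Icc 0 t)) {s : ℝ}
    (hs : s ∈ Icc 0 t) : speedSq (n := n) t x s = speedSq (n := n) t x' s := by
  have hd := mfderivWithin_congr (I := 𝓘(ℝ, ℝ)) (I' := 𝓡 n) h (h hs)
  have hd' := congrArg (fun f : ℝ →L[ℝ] Model n => f 1) hd
  exact congrArg (· ^ 2) (norm_tangent_congr (h hs) hd')

omit [IsManifold (𝓡 n) ∞ M] in
theorem norm_smul_tangent (p : M) (a : ℝ) (v : TangentSpace (𝓡 n) p) :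
    ‖a • v‖ = |a| * ‖v‖ := norm_smul a v

omit [IsManifold (𝓡 n) ∞ M] in
/-- Reparametrising a curve by `s ↦ a s` multiplies its squared speed by `a²`. -/
theorem speedSq_comp_mul {a T : ℝ} (ha : 0 < a) (x : ℝ → M) {s : ℝ} (hT : 0 < T)
    (hs : s ∈ Icc 0 T) :
    speedSq (n := n) T (fun u => x (a * u)) s = a ^ 2 * speedSq (n := n) (a * T) x (a * s) := by
  have hmul (b : ℝ) (S : Set ℝ) (u : ℝ) :
      HasMFDerivWithinAt 𝓘(ℝ, ℝ) 𝓘(ℝ, ℝ) (fun u : ℝ => b * u) S u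
        (b • ContinuousLinearMap.id ℝ ℝ) :=
    (((hasFDerivAt_id u).const_smul b).hasFDerivWithinAt).hasMFDerivWithinAt
  have hud : UniqueMDiffWithinAt 𝓘(ℝ, ℝ) (Icc 0 T) s :=
    (uniqueDiffOn_Icc hT s hs).uniqueMDiffWithinAt
  by_cases hx : MDifferentiableWithinAt 𝓘(ℝ, ℝ) (𝓡 n) x (Icc 0 (a * T)) (a * s)
  · have h := (hx.hasMFDerivWithinAt.comp s (hmul a (Icc 0 T) s) (mapsTo_mul_Icc ha T)).mfderivWithin
      hud
    have h' : (mfderivWithin 𝓘(ℝ, ℝ) (𝓡 n) (fun u => x (a * u)) (Icc 0 T) s : ℝ →L[ℝ] Model n) 1 =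
        a • (mfderivWithin 𝓘(ℝ, ℝ) (𝓡 n) x (Icc 0 (a * T)) (a * s) : ℝ →L[ℝ] Model n) 1 := by
      refine (congrArg (fun f : ℝ →L[ℝ] Model n => f 1) h).trans ?_
      exact ContinuousLinearMap.map_smul
        (mfderivWithin 𝓘(ℝ, ℝ) (𝓡 n) x (Icc 0 (a * T)) (a * s) : ℝ →L[ℝ] Model n) a 1
    have hn := (norm_tangent_congr (n := n) (rfl : x (a * s) = x (a * s)) h').trans
      (norm_smul_tangent (x (a * s)) a _)
    refine (congrArg (· ^ 2) hn).trans ?_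
    rw [mul_pow, sq_abs]
    rfl
  -- Undoing the time change shows that both curves fail to be differentiable together, so both
  -- derivatives are the default `0`.
  · have hx' : ¬ MDifferentiableWithinAt 𝓘(ℝ, ℝ) (𝓡 n) (fun u => x (a * u)) (Icc 0 T) s := by
      intro hd
      refine hx ?_
      have hs' : a⁻¹ * (a * s) = s := inv_mul_cancel_left₀ ha.ne' s
      have hm : MapsTo (fun u => a⁻¹ * u) (Icc 0 (a * T)) (Icc 0 T) := by
        simpa [inv_mul_cancel_left₀ ha.ne'] using mapsTo_mul_Icc (inv_pos.2 ha) (a * T)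
      have h := MDifferentiableWithinAt.comp (I := 𝓘(ℝ, ℝ)) (I' := 𝓘(ℝ, ℝ)) (I'' := 𝓡 n)
        (u := Icc 0 T) (f := fun u => a⁻¹ * u) (g := fun u => x (a * u)) (a * s) (by rwa [hs'])
        (hmul a⁻¹ (Icc 0 (a * T)) (a * s)).mdifferentiableWithinAt hm
      refine h.congr (fun u _ => ?_) ?_ <;>
        simp only [Function.comp_apply, mul_inv_cancel_left₀ ha.ne']
    have h0 : ∀ p : M, ‖(0 : TangentSpace (𝓡 n) p)‖ = 0 := fun p => norm_zero
    simp only [speedSq]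
    rw [mfderivWithin_zero_of_not_mdifferentiableWithinAt hx,
      mfderivWithin_zero_of_not_mdifferentiableWithinAt hx']
    change ‖(0 : TangentSpace (𝓡 n) (x (a * s)))‖ ^ 2 =
      a ^ 2 * ‖(0 : TangentSpace (𝓡 n) (x (a * s)))‖ ^ 2
    rw [h0]
    ring

/-- If the lowest energy path exists, the one of the scaled Hamiltonian in the time `1` has
`t` times the action. -/
theorem actionPhi_eq (V : M → ℝ) {t : ℝ} (ht : 0 < t) {x y : M} {μ : ℝ}
    {γ : ℝ → Cotangent n M} (hγ : IsOnlyLowPath (hamiltonian V) t x y μ γ) :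
    actionPhi (n := n) V t x y = t * actionS (n := n) V t x y := by
  -- The chosen path comes with its own bound `ν`, possibly different from `μ`.
  obtain ⟨ν, hν⟩ : IsLowestEnergyPath (n := n) (hamiltonian V) t x y
      (lowestEnergyPath (hamiltonian V) t x y) :=
    isLowestEnergyPath_lowestEnergyPath ⟨γ, μ, hγ⟩
  set η : ℝ → Cotangent n M := lowestEnergyPath (hamiltonian V) t x y
  have hr : IsOnlyLowPath (scaledHamiltonian V t) 1 x y (t * ν) (rescale t η) :=
    IsOnlyLowPath.rescale ht (scaledHamiltonian_dilate V t) (by rwa [mul_one])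
  -- Both lowest energy paths are arbitrary choices off their time intervals, so agreement holds on
  -- `[0, 1]` only; the integral sees nothing else.
  have heq : EqOn (lowestEnergyPath (scaledHamiltonian V t) 1 x y) (rescale t η) (Icc 0 1) :=
    (isLowestEnergyPath_lowestEnergyPath ⟨_, _, hr⟩).eqOn ⟨_, hr⟩
  have hint : actionPhi (n := n) V t x y = ∫ s in (0 : ℝ)..1,
      t ^ 2 * (fun r => speedSq (n := n) t (fun u => (η u).proj) r / 2 - V (η r).proj) (t * s) := by
    refine intervalIntegral.integral_congr fun s hs => ?_
    rw [uIcc_of_le zero_le_one] at hs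
    have hproj : EqOn (fun u => (lowestEnergyPath (scaledHamiltonian V t) 1 x y u).proj)
        (fun u => (η (t * u)).proj) (Icc 0 1) := fun u hu =>
      (congrArg (fun z : Cotangent n M => z.proj) (heq hu) :
        _ = (rescale t η u).proj)
    have h1 := speedSq_congr (n := n) hproj hs
    have h2 := speedSq_comp_mul (n := n) ht (fun u => (η u).proj) one_pos hs
    have h3 := hproj hs
    simp only [mul_one] at h1 h2 h3 ⊢
    rw [h1, h2, h3]
    ring
  have hsub := intervalIntegral.integral_comp_mul_left (a := 0) (b := 1)
    (fun r => speedSq (n := n) t (fun u => (η u).proj) r / 2 - V (η r).proj) ht.ne'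
  rw [hint, intervalIntegral.integral_const_mul]
  refine (congrArg (t ^ 2 * ·) hsub).trans ?_
  rw [mul_zero, mul_one, smul_eq_mul, pow_two]
  change t * t * (t⁻¹ * actionS (n := n) V t x y) = t * actionS (n := n) V t x y
  field_simp

end Scaling

end LowEnergy

theorem theorem4p7 {n : ℕ} {M : Type*} [TopologicalSpace M] [T2Space M] [CompactSpace M]
    [ConnectedSpace M] [ChartedSpace (EuclideanSpace ℝ (Fin n)) M] [IsManifold (𝓡 n) ∞ M]
    [RiemannianBundle (fun x : M => TangentSpace (𝓡 n) x)]
    [IsContMDiffRiemannianBundle (𝓡 n) ∞ (EuclideanSpace ℝ (Fin n))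
      (fun x : M => TangentSpace (𝓡 n) x)]
    (V : M → ℝ) (hV : ContMDiff (𝓡 n) 𝓘(ℝ, ℝ) ∞ V)
    (t₀ μ : ℝ) (ht₀ : 0 < t₀) (N : Set (M × M)) (hN : N ∈ 𝓝ˢ (diagonal M))
    (huniq : ∀ t ∈ Ioo 0 t₀, ∀ x y : M, (x, y) ∈ N →
      ∃ γ, LowEnergy.IsOnlyLowPath (n := n) (LowEnergy.hamiltonian V) t x y (μ / t) γ) :
    ∀ t ∈ Ioo 0 t₀, ∀ x y : M, (x, y) ∈ N →
      (∃ γ, LowEnergy.IsOnlyLowPath (n := n) (LowEnergy.scaledHamiltonian V t) 1 x y μ γ) ∧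
      LowEnergy.actionS (n := n) V t x y = t⁻¹ * LowEnergy.actionPhi (n := n) V t x y := by
  intro t ht x y hxy
  have ht0 : 0 < t := ht.1
  obtain ⟨γ, hγ⟩ := huniq t ht x y hxy
  refine ⟨⟨LowEnergy.rescale t γ, ?_⟩, ?_⟩
  · have h := LowEnergy.IsOnlyLowPath.rescale (T := 1) ht0
      (LowEnergy.scaledHamiltonian_dilate V t) (by rwa [mul_one])
    rwa [mul_div_cancel₀ μ ht0.ne'] at h
  · rw [LowEnergy.actionPhi_eq V ht0 hγ, inv_mul_cancel_left₀ ht0.ne']
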